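/- Let $\pm[n]=\{\pm1,\dots,\pm n\}$ and let $D_n$ be the set of permutations $\pi$ of $\pm[n]$ with $\pi(-i)=-\pi(i)$ for all $i$ and with an even number of negative entries among $\pi(1),\dots,\pi(n)$. Let $$D_n(x)=\sum_{\pi\in D_n}x^{\mathrm{des}_D(\pi)},\qquad \mathrm{des}_D(\pi)=|\{i\in\{1,\dots,n\}:\pi(i-1)>\pi(i)\}|,\quad \pi(0):=-\pi(2),$$ be the Eulerian polynomial of type $D$. Define the tangent numbers $T(n,1)$ and the Euler (secant) numbers $S(n,0)$ by $$\tan x=\sum_{n\ge 1}T(n,1)\frac{x^n}{n!},\qquad \sec x=\sum_{n\ge 0}S(n,0)\frac{x^n}{n!}.$$ Then $D_{2n-1}(-1)=0$ for every $n\ge 2$, and for every $n\ge 1$ $$D_{2n}(-1)=(-4)^n\bigl(S(2n,0)-n\,T(2n-1,1)\bigr).$$ -/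

import Mathlib

noncomputable section

/-- The set `±[n] = {±1, …, ±n}`. -/
def plusMinus (n : ℕ) : Finset ℤ := (Finset.Icc (-(n : ℤ)) n).erase 0

/-- The value `π(i)` of a permutation `π` of `±[n]` at an integer `i`; integers outside `±[n]` are
fixed (this matters only for `π(2)` when `n ≤ 1`). -/
def permValue {n : ℕ} (π : Equiv.Perm (plusMinus n)) (i : ℤ) : ℤ :=
  Equiv.Perm.ofSubtype π i

/-- The signed permutations of `±[n]`: the permutations `π` with `π(-i) = -π(i)`. -/
def coxeterB (n : ℕ) : Finset (Equiv.Perm (plusMinus n)) :=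
  {π | ∀ i ∈ plusMinus n, permValue π (-i) = -permValue π i}

/-- The elements of `B_n` with an even number of negative entries among `π(1), …, π(n)`. -/
def coxeterD (n : ℕ) : Finset (Equiv.Perm (plusMinus n)) :=
  {π ∈ coxeterB n | Even ({i ∈ Finset.Icc (1 : ℤ) n | permValue π i < 0} : Finset ℤ).card}

/-- The word `π(0) π(1) ⋯ π(n)` with the convention `π(0) = -π(2)`. -/
def wordD {n : ℕ} (π : Equiv.Perm (plusMinus n)) (i : ℤ) : ℤ :=
  if i = 0 then -permValue π 2 else permValue π i

/-- The number of type `D` descents, `|{i ∈ [n] : π(i-1) > π(i)}|` with `π(0) = -π(2)`. -/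
def desD {n : ℕ} (π : Equiv.Perm (plusMinus n)) : ℕ :=
  ({i ∈ Finset.Icc (1 : ℤ) n | wordD π (i - 1) > wordD π i} : Finset ℤ).card

/-- The Eulerian polynomial of type `D`. -/
def eulerianD (n : ℕ) : Polynomial ℤ := ∑ π ∈ coxeterD n, Polynomial.X ^ desD π

/-- The power series of the secant at `0`. -/
def secSeries : PowerSeries ℚ := (PowerSeries.cos ℚ)⁻¹

/-- The power series of the tangent at `0`. -/
def tanSeries : PowerSeries ℚ := PowerSeries.sin ℚ * secSeries

/-- The tangent numbers of order `k`, given by `tan^k(x) = ∑ T(n,k) x^n / n!`. -/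
def tangentNumber (n k : ℕ) : ℚ := (n.factorial : ℚ) * PowerSeries.coeff n (tanSeries ^ k)

/-- The secant numbers of order `k`, given by `sec(x) tan^k(x) = ∑ S(n,k) x^n / n!`. -/
def secantNumber (n k : ℕ) : ℚ :=
  (n.factorial : ℚ) * PowerSeries.coeff n (secSeries * tanSeries ^ k)

end

-- At `x = -1` each permutation counts with sign `(-1)^des_D`. Write it as a signed word and group
-- the words by their absolute values `a, b, …`. The steps from `-π(2)` to `π(1)` and from `π(1)` to
-- `π(2)` contribute together a sign depending only on `|π(1)|` and `|π(2)|`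
-- (`stepSign_neg_mul_stepSign`). So the sign of `π(1)` serves only to make the number of negative
-- entries even, and the other signs are free.
--
-- Summing over the free signs kills every absolute word whose tail is not alternating `b < c > ⋯`
-- of odd length (`sum_signings_chainSign`, `sum_signings_evenSignD`). What survives is, up to a
-- power of 2 and a sign, the number of words with alternating tail minus twice the number of those
-- with also `a > b`.
--
-- These counts are tangent and secant numbers by André's theorem (`upCount_eq`, `downCount_eq`). It
-- is proved by cutting words into a decreasing prefix and an alternating rest, with periodic
-- weights that make nearly all cuts cancel; this gives `cos · sec = 1` and `sin · sec = tan`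
-- combinatorially.

-- Words on a finite set and their splittings

/-- The enumerations of a finite set of integers, as lists without repetitions. -/
def words (S : Finset ℤ) : Finset (List ℤ) :=
  ⟨Multiset.lists S.val, Multiset.lists_nodup_finset S⟩

theorem mem_words {S : Finset ℤ} {l : List ℤ} : l ∈ words S ↔ l.Nodup ∧ l.toFinset = S := by
  simp only [words, Finset.mem_mk, Multiset.mem_lists_iff]
  constructor
  · intro h
    have hn : l.Nodup := by
      have := S.nodup
      rw [h] at this
      exact Multiset.coe_nodup.1 this
    refine ⟨hn, ?_⟩
    ext x
    rw [List.mem_toFinset, ← Finset.mem_val, h]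
    exact Iff.rfl
  · rintro ⟨hn, rfl⟩
    rw [List.toFinset_val, hn.dedup]
    rfl

theorem length_of_mem_words {S : Finset ℤ} {l : List ℤ} (h : l ∈ words S) : l.length = S.card := by
  obtain ⟨hn, rfl⟩ := mem_words.1 h
  exact (List.toFinset_card_of_nodup hn).symm

/-- The combinatorial form of a product of exponential generating functions: a cut word is a choice
of the letters of the prefix and an ordering of each side. -/
theorem sum_words_splits (S : Finset ℤ) (G : List ℤ → List ℤ → ℚ) :
    ∑ l ∈ words S, ∑ k ∈ Finset.range (l.length + 1), G (l.take k) (l.drop k) =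
      ∑ T ∈ S.powerset, ∑ u ∈ words T, ∑ v ∈ words (S \ T), G u v := by
  simp_rw [← Finset.sum_product']
  rw [Finset.sum_sigma', Finset.sum_sigma']
  refine Finset.sum_bij' (fun x _ => ⟨(x.1.take x.2).toFinset, (x.1.take x.2, x.1.drop x.2)⟩)
    (fun y _ => ⟨y.2.1 ++ y.2.2, y.2.1.length⟩) ?_ ?_ ?_ ?_ ?_
  · rintro ⟨l, k⟩ h
    simp only [Finset.mem_sigma, mem_words, Finset.mem_range] at h
    obtain ⟨⟨hn, rfl⟩, hk⟩ := h
    have hn' := hn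
    rw [← List.take_append_drop k l, List.nodup_append] at hn'
    simp only [Finset.mem_sigma, Finset.mem_powerset, Finset.mem_product, mem_words]
    refine ⟨?_, ⟨hn'.1, trivial⟩, hn'.2.1, ?_⟩
    · intro x hx
      simp only [List.mem_toFinset] at hx ⊢
      exact List.mem_of_mem_take hx
    · ext x
      have : x ∈ l ↔ x ∈ l.take k ∨ x ∈ l.drop k := by
        conv_lhs => rw [← List.take_append_drop k l]
        exact List.mem_append
      simp only [List.mem_toFinset, Finset.mem_sdiff, this]
      have h3 := hn'.2.2 x
      constructor
      · intro hx
        exact ⟨Or.inr hx, fun h => h3 h x hx rfl⟩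
      · tauto
  · rintro ⟨T, u, v⟩ h
    simp only [Finset.mem_sigma, Finset.mem_powerset, Finset.mem_product, mem_words] at h
    obtain ⟨hT, ⟨hu, rfl⟩, hv, hv'⟩ := h
    simp only [Finset.mem_sigma, mem_words, Finset.mem_range, List.length_append,
      List.toFinset_append, hv', Finset.union_sdiff_of_subset hT, List.nodup_append]
    refine ⟨⟨⟨hu, hv, ?_⟩, trivial⟩, by omega⟩
    rintro a ha b hb rfl
    have : a ∈ v.toFinset := List.mem_toFinset.2 hb
    rw [hv', Finset.mem_sdiff, List.mem_toFinset] at this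
    exact this.2 ha
  · rintro ⟨l, k⟩ h
    simp only [Finset.mem_sigma, Finset.mem_range] at h
    simp only [List.take_append_drop, List.length_take]
    congr
    omega
  · rintro ⟨T, u, v⟩ h
    simp only [Finset.mem_sigma, Finset.mem_powerset, Finset.mem_product, mem_words] at h
    obtain ⟨hT, ⟨hu, rfl⟩, hv, hv'⟩ := h
    simp
  · rintro ⟨l, k⟩ h
    rfl

/-- The condition on `F []` covers `S = ∅`, where the empty word is its own tail but there is no
first letter. -/
theorem sum_words_cons (S : Finset ℤ) (F : List ℤ → ℚ) (hF : F [] = 0) :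
    ∑ l ∈ words S, F l.tail = ∑ a ∈ S, ∑ v ∈ words (S.erase a), F v := by
  rw [Finset.sum_sigma']
  by_cases hS : S = ∅
  · subst hS
    have : ∀ l ∈ words ∅, F l.tail = 0 := by
      intro l hl
      have := length_of_mem_words hl
      rw [Finset.card_empty, List.length_eq_zero_iff] at this
      simp [this, hF]
    rw [Finset.sum_eq_zero this]
    rfl
  refine Finset.sum_bij' (fun l _ => ⟨l.headI, l.tail⟩) (fun y _ => y.1 :: y.2) ?_ ?_ ?_ ?_ ?_
  · intro l h
    rw [mem_words] at h
    obtain ⟨hn, rfl⟩ := h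
    cases l with
    | nil => simp at hS
    | cons a l =>
      rw [List.nodup_cons] at hn
      simp [mem_words, hn.2, hn.1]
  · rintro ⟨a, v⟩ h
    simp only [Finset.mem_sigma, mem_words] at h
    obtain ⟨ha, hn, hv⟩ := h
    have : a ∉ v.toFinset := by simp [hv]
    simp only [mem_words, List.nodup_cons, List.toFinset_cons, hv, Finset.insert_erase ha]
    exact ⟨⟨by simpa using this, hn⟩, trivial⟩
  · intro l h
    rw [mem_words] at h
    obtain ⟨hn, rfl⟩ := h
    cases l with
    | nil => simp at hS
    | cons a l => rfl
  · intro y h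
    rfl
  · intro l h
    rfl

-- Alternating words and decreasing prefixes

open Classical in
/-- The indicator function of the strictly decreasing words. -/
noncomputable def decInd (l : List ℤ) : ℚ := if l.IsChain (· > ·) then 1 else 0

theorem sum_words_decInd (S : Finset ℤ) : ∑ u ∈ words S, decInd u = 1 := by
  rw [Finset.sum_eq_single (S.sort (· ≥ ·))]
  · rw [decInd, if_pos]
    exact List.isChain_iff_pairwise.2 (Finset.sortedGT_sort S).pairwise
  · intro l hl hne
    rw [decInd, if_neg]
    intro hc
    apply hne
    rw [List.isChain_iff_pairwise] at hc
    obtain ⟨hn, rfl⟩ := mem_words.1 hl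
    refine List.Perm.eq_of_pairwise (le := (· ≥ ·)) ?_ (hc.imp fun h => le_of_lt h)
      (Finset.pairwise_sort _ _) ?_
    · intro a b _ _ h1 h2
      exact le_antisymm h2 h1
    · refine (List.perm_ext_iff_of_nodup hn (Finset.sort_nodup _ _)).2 fun a => ?_
      simp
  · intro h
    exact absurd (mem_words.2 ⟨Finset.sort_nodup _ _, Finset.sort_toFinset _ _⟩) h

mutual
  /-- The indicator function of the words `a₁ < a₂ > a₃ < ⋯ > aₙ` with `n` odd. -/
  def upInd : List ℤ → ℚ
    | [] => 0
    | [_] => 1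
    | a :: b :: l => if a < b then downInd (b :: l) else 0
  /-- The indicator function of the words `a₁ > a₂ < a₃ > ⋯ > aₙ` with `n` even. -/
  def downInd : List ℤ → ℚ
    | [] => 1
    | [_] => 0
    | a :: b :: l => if b < a then upInd (b :: l) else 0
end

theorem upInd_cons_cons (a b : ℤ) (l : List ℤ) :
    upInd (a :: b :: l) = if a < b then downInd (b :: l) else 0 := by
  rw [upInd]

theorem downInd_cons_cons (a b : ℤ) (l : List ℤ) :
    downInd (a :: b :: l) = if b < a then upInd (b :: l) else 0 := by
  rw [downInd]

/-- Induction on the word: if `b < a`, the cut `k = 0` cancels the `w 2` term left by the induction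
hypothesis, since `w 2 = -w 0`; if `a < b`, only the cut `k = 0` survives. -/
theorem sum_decInd_cons (w : ℕ → ℚ) (hw : ∀ k, w (k + 2) = -w k) (a : ℤ) (l : List ℤ)
    (hl : (a :: l).Nodup) :
    ∑ k ∈ Finset.range (l.length + 1), w k * decInd (a :: l.take k) * downInd (l.drop k) =
      w 0 * upInd (a :: l) + w 1 * downInd (a :: l) := by
  induction l generalizing a w with
  | nil => simp [decInd, upInd, downInd]
  | cons b l ih =>
    have hab : a ≠ b := by
      intro h
      simp [h] at hl
    have h := ih (fun k => w (k + 1)) (fun k => hw (k + 1)) b (List.nodup_cons.1 hl).2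
    have hdec : ∀ t, decInd (a :: b :: t) = if b < a then decInd (b :: t) else 0 := by
      intro t
      simp only [decInd, List.isChain_cons_cons]
      split_ifs <;> tauto
    rw [List.length_cons, Finset.sum_range_succ']
    simp only [List.take_succ_cons, List.drop_succ_cons, hdec, List.take_zero, List.drop_zero]
    have h0 : decInd [a] = 1 := by simp [decInd]
    have hw0 := hw 0
    by_cases hba : b < a
    · simp only [if_pos hba, h, h0, upInd_cons_cons, downInd_cons_cons, if_neg hba.not_gt]
      simp only [zero_add] at hw0 ⊢
      rw [hw0]
      ring
    · have hab' : a < b := lt_of_le_of_ne (not_lt.1 hba) hab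
      simp [if_neg hba, if_pos hab', upInd_cons_cons, downInd_cons_cons, h0]

theorem sum_decInd_splits (w : ℕ → ℚ) (hw : ∀ k, w (k + 2) = -w k) (l : List ℤ)
    (hl : l.Nodup) :
    ∑ k ∈ Finset.range (l.length + 1), w k * decInd (l.take k) * downInd (l.drop k) =
      w 1 * upInd l + if l = [] then w 0 else 0 := by
  cases l with
  | nil => simp [decInd, upInd, downInd]
  | cons a l =>
    have h := sum_decInd_cons (fun k => w (k + 1)) (fun k => hw (k + 1)) a l hl
    rw [List.length_cons, Finset.sum_range_succ']
    simp only [List.take_succ_cons, List.drop_succ_cons, h]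
    have h0 : decInd [] = 1 := by simp [decInd]
    have hw0 := hw 0
    simp only [zero_add] at hw0
    simp [h0, hw0]

/-- The number of words `a₁ < a₂ > ⋯ > aₙ`, `n` odd, enumerating `S`. -/
def upCount (S : Finset ℤ) : ℚ := ∑ l ∈ words S, upInd l

/-- The number of words `a₁ > a₂ < ⋯ > aₙ`, `n` even, enumerating `S`. -/
def downCount (S : Finset ℤ) : ℚ := ∑ l ∈ words S, downInd l

/-- A set has a single decreasing enumeration, so a prefix contributes only its weight. The weights
`cosSeq` and `sinSeq` turn this into the identities for `sec` and `tan`. -/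
theorem sum_powerset_mul_downCount (w : ℕ → ℚ) (hw : ∀ k, w (k + 2) = -w k) (S : Finset ℤ) :
    ∑ T ∈ S.powerset, w T.card * downCount (S \ T) =
      w 1 * upCount S + if S = ∅ then w 0 else 0 := by
  have h := sum_words_splits S fun u v => w u.length * decInd u * downInd v
  have h1 : ∑ l ∈ words S, ∑ k ∈ Finset.range (l.length + 1),
      w (l.take k).length * decInd (l.take k) * downInd (l.drop k) =
      ∑ l ∈ words S, (w 1 * upInd l + if S = ∅ then w 0 else 0) := by
    refine Finset.sum_congr rfl fun l hl => ?_
    obtain ⟨hn, rfl⟩ := mem_words.1 hl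
    have := sum_decInd_splits w hw l hn
    simp only [List.toFinset_eq_empty_iff]
    rw [← this]
    refine Finset.sum_congr rfl fun k hk => ?_
    rw [Finset.mem_range] at hk
    rw [List.length_take, min_eq_left (by omega)]
  rw [h1, Finset.sum_add_distrib, ← Finset.mul_sum] at h
  have h2 : ∑ l ∈ words S, (if S = ∅ then w 0 else 0) = if S = ∅ then w 0 else 0 := by
    split_ifs with hS
    · subst hS
      have : words ∅ = {[]} := by
        ext l
        simp only [mem_words, List.toFinset_eq_empty_iff, Finset.mem_singleton]
        constructor
        · exact fun h => h.2
        · rintro rfl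
          simp
      simp [this]
    · simp
  rw [h2] at h
  rw [upCount, h]
  refine Finset.sum_congr rfl fun T hT => ?_
  have h3 : ∀ u ∈ words T, ∑ v ∈ words (S \ T), w u.length * decInd u * downInd v =
      decInd u * (w T.card * downCount (S \ T)) := by
    intro u hu
    rw [← Finset.mul_sum, length_of_mem_words hu, downCount]
    ring
  rw [Finset.sum_congr rfl h3, ← Finset.sum_mul, sum_words_decInd, one_mul]

-- André's theorem: secant and tangent numbers

theorem sum_powerset_eq_coeff_mul (f g : PowerSeries ℚ) (S : Finset ℤ) :
    ∑ T ∈ S.powerset, (T.card.factorial * PowerSeries.coeff T.card f) *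
      ((S \ T).card.factorial * PowerSeries.coeff (S \ T).card g) =
      S.card.factorial * PowerSeries.coeff S.card (f * g) := by
  have h : ∀ T ∈ S.powerset, (T.card.factorial * PowerSeries.coeff T.card f) *
      ((S \ T).card.factorial * PowerSeries.coeff (S \ T).card g) =
      (fun k => (k.factorial * PowerSeries.coeff k f) *
      ((S.card - k).factorial * PowerSeries.coeff (S.card - k) g)) T.card := by
    intro T hT
    rw [Finset.card_sdiff_of_subset (Finset.mem_powerset.1 hT)]
  rw [Finset.sum_congr rfl h, Finset.sum_powerset_apply_card
    (fun k => ((k.factorial : ℚ) * PowerSeries.coeff k f) *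
      (((S.card - k).factorial : ℚ) * PowerSeries.coeff (S.card - k) g)),
    PowerSeries.coeff_mul, Finset.Nat.sum_antidiagonal_eq_sum_range_succ_mk, Finset.mul_sum]
  refine Finset.sum_congr rfl fun k hk => ?_
  have hk' : k ≤ S.card := by
    rw [Finset.mem_range] at hk
    omega
  have := Nat.choose_mul_factorial_mul_factorial hk'
  rw [nsmul_eq_mul, ← this]
  push_cast
  ring

theorem cos_mul_secSeries : PowerSeries.cos ℚ * secSeries = 1 :=
  PowerSeries.mul_inv_cancel _ (by simp [PowerSeries.cos])

/-- The alternating sequence `1, 0, -1, 0, …`. -/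
def cosSeq (k : ℕ) : ℚ := if Even k then (-1) ^ (k / 2) else 0

/-- The alternating sequence `0, 1, 0, -1, …`. -/
def sinSeq (k : ℕ) : ℚ := if Even k then 0 else (-1) ^ (k / 2)

theorem cosSeq_add_two (k : ℕ) : cosSeq (k + 2) = -cosSeq k := by
  simp only [cosSeq, Nat.even_add, even_two, iff_true, Nat.add_div_right k two_pos]
  split_ifs <;> simp [pow_succ]

theorem sinSeq_add_two (k : ℕ) : sinSeq (k + 2) = -sinSeq k := by
  simp only [sinSeq, Nat.even_add, even_two, iff_true, Nat.add_div_right k two_pos]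
  split_ifs <;> simp [pow_succ]

theorem factorial_mul_coeff_cos (k : ℕ) :
    (k.factorial : ℚ) * PowerSeries.coeff k (PowerSeries.cos ℚ) = cosSeq k := by
  have : (k.factorial : ℚ) ≠ 0 := by positivity
  simp only [PowerSeries.cos, PowerSeries.coeff_mk, cosSeq]
  split_ifs
  · simp; field_simp
  · simp

theorem factorial_mul_coeff_sin (k : ℕ) :
    (k.factorial : ℚ) * PowerSeries.coeff k (PowerSeries.sin ℚ) = sinSeq k := by
  have : (k.factorial : ℚ) ≠ 0 := by positivity
  simp only [PowerSeries.sin, PowerSeries.coeff_mk, sinSeq]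
  split_ifs
  · simp
  · simp; field_simp

/-- Both sides satisfy the recursion given by `cos · sec = 1`; the term `T = ∅`, of weight `cosSeq 0
= 1`, isolates the value at `S`. -/
theorem downCount_eq (S : Finset ℤ) : downCount S = secantNumber S.card 0 := by
  induction S using Finset.strongInduction with
  | H S ih =>
    have h1 := sum_powerset_mul_downCount cosSeq cosSeq_add_two S
    have h2 := sum_powerset_eq_coeff_mul (PowerSeries.cos ℚ) secSeries S
    rw [cos_mul_secSeries] at h2
    simp only [factorial_mul_coeff_cos] at h2
    rw [← Finset.add_sum_erase _ _ (Finset.empty_mem_powerset S)] at h1 h2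
    have h4 : ∑ T ∈ S.powerset.erase ∅, cosSeq T.card * downCount (S \ T) =
        ∑ T ∈ S.powerset.erase ∅, cosSeq T.card *
          ((S \ T).card.factorial * PowerSeries.coeff (S \ T).card secSeries) := by
      refine Finset.sum_congr rfl fun T hT => ?_
      rw [Finset.mem_erase, Finset.mem_powerset] at hT
      rw [ih _ (Finset.sdiff_ssubset hT.2 (Finset.nonempty_iff_ne_empty.2 hT.1)), secantNumber,
        pow_zero, mul_one]
    have h5 : (if S = ∅ then cosSeq 0 else 0) =
        (S.card.factorial : ℚ) * PowerSeries.coeff S.card (1 : PowerSeries ℚ) := by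
      rw [PowerSeries.coeff_one]
      by_cases hS : S = ∅ <;> simp [hS, cosSeq]
    have h6 : cosSeq 1 = 0 := by simp [cosSeq]
    have h7 : cosSeq 0 = 1 := by simp [cosSeq]
    rw [h4, h5, ← h2, h6] at h1
    simp only [Finset.card_empty, h7, Finset.sdiff_empty] at h1
    rw [secantNumber, pow_zero, mul_one]
    linarith

theorem upCount_eq (S : Finset ℤ) : upCount S = tangentNumber S.card 1 := by
  have h1 := sum_powerset_mul_downCount sinSeq sinSeq_add_two S
  have h2 := sum_powerset_eq_coeff_mul (PowerSeries.sin ℚ) secSeries S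
  simp only [factorial_mul_coeff_sin] at h2
  have h3 : sinSeq 0 = 0 := by simp [sinSeq]
  have h4 : sinSeq 1 = 1 := by simp [sinSeq]
  simp only [downCount_eq, secantNumber, pow_zero, mul_one] at h1
  rw [h2, h3, h4] at h1
  rw [tangentNumber, pow_one, tanSeries, h1]
  simp

theorem upInd_downInd_parity (l : List ℤ) :
    (Even l.length → upInd l = 0) ∧ (Odd l.length → downInd l = 0) := by
  induction l with
  | nil => simp [upInd]
  | cons a l ih =>
    cases l with
    | nil => simp [downInd]
    | cons b l =>
      rw [upInd_cons_cons, downInd_cons_cons, List.length_cons, Nat.even_add_one, Nat.odd_add_one,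
        Nat.not_even_iff_odd, Nat.not_odd_iff_even]
      exact ⟨fun h => by rw [ih.2 h, ite_self], fun h => by rw [ih.1 h, ite_self]⟩

theorem tangentNumber_of_even {n : ℕ} (hn : Even n) : tangentNumber n 1 = 0 := by
  have h := upCount_eq (Finset.Icc 1 (n : ℤ))
  rw [Int.card_Icc, add_sub_cancel_right, Int.toNat_natCast] at h
  rw [← h]
  refine Finset.sum_eq_zero fun l hl => (upInd_downInd_parity l).1 ?_
  simpa [length_of_mem_words hl] using hn

theorem secantNumber_of_odd {n : ℕ} (hn : Odd n) : secantNumber n 0 = 0 := by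
  have h := downCount_eq (Finset.Icc 1 (n : ℤ))
  rw [Int.card_Icc, add_sub_cancel_right, Int.toNat_natCast] at h
  rw [← h]
  refine Finset.sum_eq_zero fun l hl => (upInd_downInd_parity l).2 ?_
  simpa [length_of_mem_words hl] using hn

-- Summation over the choices of signs

/-- The lists obtained from `l` by choosing a sign for every entry. -/
def signings : List ℤ → Finset (List ℤ)
  | [] => {[]}
  | a :: l => (signings l).image (List.cons a) ∪ (signings l).image (List.cons (-a))

theorem mem_signings {l m : List ℤ} (hl : ∀ a ∈ l, 0 < a) :
    m ∈ signings l ↔ m.map abs = l := by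
  induction l generalizing m with
  | nil => simp [signings]
  | cons a l ih =>
    have ha : 0 < a := hl a (by simp)
    have hl' : ∀ b ∈ l, 0 < b := fun b hb => hl b (by simp [hb])
    cases m with
    | nil => simp [signings]
    | cons x m =>
      have := ih (m := m) hl'
      simp only [signings, Finset.mem_union, Finset.mem_image, List.cons.injEq, List.map_cons,
        abs_eq ha.le, ← this]
      constructor
      · rintro (⟨_, h, rfl, rfl⟩ | ⟨_, h, rfl, rfl⟩) <;> simp [h]
      · rintro ⟨rfl | rfl, h⟩
        · exact Or.inl ⟨m, h, rfl, rfl⟩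
        · exact Or.inr ⟨m, h, rfl, rfl⟩

theorem sum_signings_cons {a : ℤ} (ha : 0 < a) (l : List ℤ) (F : List ℤ → ℚ) :
    ∑ m ∈ signings (a :: l), F m = ∑ m ∈ signings l, (F (a :: m) + F (-a :: m)) := by
  rw [signings, Finset.sum_union, Finset.sum_image, Finset.sum_image, Finset.sum_add_distrib]
  · simp
  · simp
  · rw [Finset.disjoint_left]
    simp only [Finset.mem_image]
    rintro _ ⟨m, _, rfl⟩ ⟨m', _, h⟩
    simp only [List.cons.injEq] at h
    omega

/-- The sign contributed by the step from `x` to `y`: `-1` for a descent, `1` otherwise. -/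
def stepSign (x y : ℤ) : ℚ := if y < x then -1 else 1

/-- `(-1)` to the number of descents of a word. -/
def chainSign : List ℤ → ℚ
  | [] => 1
  | [_] => 1
  | x :: y :: l => stepSign x y * chainSign (y :: l)

theorem sum_signings_chainSign_cons (x : ℤ) {b : ℤ} (hb : 0 < b) (l : List ℤ) :
    ∑ m ∈ signings (b :: l), chainSign (x :: m) =
      stepSign x b * ∑ m ∈ signings l, chainSign (b :: m) +
        stepSign x (-b) * ∑ m ∈ signings l, chainSign (-b :: m) := by
  rw [sum_signings_cons hb, Finset.sum_add_distrib, Finset.mul_sum, Finset.mul_sum]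
  rfl

/-- If `b < c`, the step from `±b` to `±c` depends only on the sign of `c`, so the two sums for `c`
are subtracted and leave `downInd`. If `b > c`, it depends only on the sign of `b`, so they are
added and leave `upInd`. Parity decides when the exponent `l.length / 2` grows. -/
theorem sum_signings_chainSign (b : ℤ) (l : List ℤ) (hn : (b :: l).Nodup)
    (hl : ∀ a ∈ b :: l, 0 < a) :
    ∑ m ∈ signings l, chainSign (b :: m) =
        2 ^ l.length * (-1) ^ (l.length / 2) * (upInd (b :: l) - downInd (b :: l)) ∧
      ∑ m ∈ signings l, chainSign (-b :: m) =
        2 ^ l.length * (-1) ^ (l.length / 2) * (upInd (b :: l) + downInd (b :: l)) := by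
  induction l generalizing b with
  | nil => simp [signings, chainSign, upInd, downInd]
  | cons c l ih =>
    obtain ⟨h1, h2⟩ := ih c (List.nodup_cons.1 hn).2 fun a ha => hl a (List.mem_cons_of_mem _ ha)
    have hb : 0 < b := hl b (by simp)
    have hc : 0 < c := hl c (by simp)
    have hbc : b ≠ c := by
      rintro rfl
      simp at hn
    obtain ⟨p1, p2⟩ := upInd_downInd_parity (c :: l)
    rw [sum_signings_chainSign_cons _ hc, sum_signings_chainSign_cons _ hc, h1, h2,
      upInd_cons_cons, downInd_cons_cons]
    rw [List.length_cons] at p1 p2 ⊢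
    rcases lt_or_gt_of_ne hbc with h | h
    · have s1 : stepSign b c = 1 := if_neg (by omega)
      have s2 : stepSign b (-c) = -1 := if_pos (by omega)
      have s3 : stepSign (-b) c = 1 := if_neg (by omega)
      have s4 : stepSign (-b) (-c) = -1 := if_pos (by omega)
      rw [s1, s2, s3, s4, if_pos h, if_neg h.not_gt]
      rcases Nat.even_or_odd (l.length + 1) with he | ho
      · obtain ⟨k, hk⟩ := he
        have e1 : (l.length + 1) / 2 = l.length / 2 + 1 := by omega
        rw [e1]
        constructor <;> ring
      · rw [p2 ho]
        constructor <;> ring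
    · have s1 : stepSign b c = -1 := if_pos (by omega)
      have s2 : stepSign b (-c) = -1 := if_pos (by omega)
      have s3 : stepSign (-b) c = 1 := if_neg (by omega)
      have s4 : stepSign (-b) (-c) = 1 := if_neg (by omega)
      rw [s1, s2, s3, s4, if_neg h.not_gt, if_pos h]
      rcases Nat.even_or_odd (l.length + 1) with he | ho
      · rw [p1 he]
        constructor <;> ring
      · obtain ⟨k, hk⟩ := ho
        have e1 : (l.length + 1) / 2 = l.length / 2 := by omega
        rw [e1]
        constructor <;> ring

/-- `(-1)` to the number of type `D` descents of a signed word, as a function of the word. -/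
def signD : List ℤ → ℚ
  | x :: y :: l => stepSign |x| |y| * chainSign (y :: l)
  | _ => 1

/-- `signD` restricted to the words with an even number of negative entries. -/
def evenSignD (m : List ℤ) : ℚ := if Even (m.countP (· < 0)) then signD m else 0

/-- Exactly one sign of `a` makes the number of negative entries even, and `signD` does not see that
sign. -/
theorem evenSignD_add_neg {a : ℤ} (ha : 0 < a) (y : ℤ) (m : List ℤ) :
    evenSignD (a :: y :: m) + evenSignD (-a :: y :: m) =
      stepSign a |y| * chainSign (y :: m) := by
  have h1 : ¬ a < 0 := by omega
  have h2 : -a < 0 := by omega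
  simp only [evenSignD, List.countP_cons (a := a), List.countP_cons (a := -a), h1, h2, signD,
    abs_neg, abs_of_pos ha, decide_true, decide_false, Nat.even_add_one, if_true,
    Bool.false_eq_true, if_false, add_zero]
  split_ifs <;> simp

/-- Adding the sums for `b` and `-b` cancels `downInd (b :: l)`. The remaining factor `stepSign a b`
is `1 - 2 · [b < a]`, whence the term `downInd (a :: b :: l)`. -/
theorem sum_signings_evenSignD (a b : ℤ) (l : List ℤ) (hn : (a :: b :: l).Nodup)
    (hl : ∀ c ∈ a :: b :: l, 0 < c) :
    ∑ m ∈ signings (a :: b :: l), evenSignD m =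
      2 * (2 ^ l.length * (-1) ^ (l.length / 2)) *
        (upInd (b :: l) - 2 * downInd (a :: b :: l)) := by
  have ha : 0 < a := hl a (by simp)
  have hb : 0 < b := hl b (by simp)
  have hab : a ≠ b := by
    rintro rfl
    simp at hn
  obtain ⟨h1, h2⟩ := sum_signings_chainSign b l (List.nodup_cons.1 hn).2
    fun c hc => hl c (List.mem_cons_of_mem _ hc)
  rw [sum_signings_cons ha, sum_signings_cons hb, Finset.sum_congr rfl fun m _ => by
    rw [evenSignD_add_neg ha, evenSignD_add_neg ha, abs_neg, abs_of_pos hb],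
    Finset.sum_add_distrib, ← Finset.mul_sum, ← Finset.mul_sum, h1, h2, downInd_cons_cons, stepSign]
  split_ifs <;> ring

theorem sum_words_evenSignD (n : ℕ) :
    ∑ l ∈ words (Finset.Icc 1 ((n + 2 : ℕ) : ℤ)), ∑ m ∈ signings l, evenSignD m =
      2 * (2 ^ n * (-1) ^ (n / 2)) *
        ((n + 2) * tangentNumber (n + 1) 1 - 2 * secantNumber (n + 2) 0) := by
  set S : Finset ℤ := Finset.Icc 1 ((n + 2 : ℕ) : ℤ) with hS
  have hc : S.card = n + 2 := by
    rw [hS, Int.card_Icc]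
    omega
  have h1 : ∀ l ∈ words S, ∑ m ∈ signings l, evenSignD m =
      2 * (2 ^ n * (-1) ^ (n / 2)) * (upInd l.tail - 2 * downInd l) := by
    intro l hl
    have hlen := length_of_mem_words hl
    obtain ⟨hn, hl'⟩ := mem_words.1 hl
    have hpos : ∀ c ∈ l, 0 < c := by
      intro c hc
      rw [← List.mem_toFinset, hl', hS, Finset.mem_Icc] at hc
      omega
    rw [hc] at hlen
    match l, hlen with
    | a :: b :: l, hlen =>
      have : l.length = n := by simpa using hlen
      rw [sum_signings_evenSignD a b l hn hpos, this, List.tail_cons]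
  rw [Finset.sum_congr rfl h1, ← Finset.mul_sum, Finset.sum_sub_distrib, ← Finset.mul_sum,
    sum_words_cons S upInd (by rw [upInd])]
  -- Whichever first letter is removed, `n + 1` letters remain, and `upCount` depends only on their
  -- number.
  have h2 : ∑ a ∈ S, ∑ v ∈ words (S.erase a), upInd v =
      ∑ a ∈ S, tangentNumber (n + 1) 1 := by
    refine Finset.sum_congr rfl fun a ha => ?_
    have := upCount_eq (S.erase a)
    rwa [Finset.card_erase_of_mem ha, hc] at this
  have h3 := downCount_eq S
  rw [downCount, hc] at h3
  rw [h2, h3, Finset.sum_const, hc, nsmul_eq_mul]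
  push_cast
  ring

-- Signed permutations as signed words

theorem Icc_one_eq_image (n : ℕ) :
    Finset.Icc (1 : ℤ) n = (Finset.range n).image fun j : ℕ => (j : ℤ) + 1 := by
  ext i
  simp only [Finset.mem_Icc, Finset.mem_image, Finset.mem_range]
  constructor
  · rintro ⟨h1, h2⟩
    exact ⟨(i - 1).toNat, by omega, by omega⟩
  · rintro ⟨j, hj, rfl⟩
    omega

theorem mem_plusMinus {n : ℕ} {i : ℤ} : i ∈ plusMinus n ↔ i ≠ 0 ∧ |i| ≤ n := by
  rw [plusMinus, Finset.mem_erase, Finset.mem_Icc, abs_le]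

theorem neg_mem_plusMinus {n : ℕ} {i : ℤ} (hi : i ∈ plusMinus n) : -i ∈ plusMinus n := by
  rw [mem_plusMinus] at *
  rwa [neg_ne_zero, abs_neg]

theorem permValue_mem {n : ℕ} (π : Equiv.Perm (plusMinus n)) {i : ℤ} (hi : i ∈ plusMinus n) :
    permValue π i ∈ plusMinus n := by
  rw [permValue, Equiv.Perm.ofSubtype_apply_of_mem π hi]
  exact (π ⟨i, hi⟩).2

theorem permValue_neg {n : ℕ} {π : Equiv.Perm (plusMinus n)} (hπ : π ∈ coxeterB n) {i : ℤ}
    (hi : i ∈ plusMinus n) : permValue π (-i) = -permValue π i := by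
  rw [coxeterB, Finset.mem_filter] at hπ
  exact hπ.2 i hi

theorem permValue_injective {n : ℕ} (π : Equiv.Perm (plusMinus n)) :
    Function.Injective (permValue π) :=
  (Equiv.Perm.ofSubtype π).injective

theorem succ_mem_plusMinus {n j : ℕ} (hj : j < n) : (j : ℤ) + 1 ∈ plusMinus n := by
  rw [mem_plusMinus, abs_of_pos (by omega)]
  omega

/-- The word `π(1) ⋯ π(n)`. -/
noncomputable def permWord {n : ℕ} (π : Equiv.Perm (plusMinus n)) : List ℤ :=
  (List.range n).map fun j : ℕ => permValue π (j + 1)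

theorem abs_permWord_mem_words {n : ℕ} {π : Equiv.Perm (plusMinus n)} (hπ : π ∈ coxeterB n) :
    (permWord π).map abs ∈ words (Finset.Icc 1 n) := by
  have hn : ((permWord π).map abs).Nodup := by
    rw [permWord, List.map_map]
    refine List.Nodup.map_on ?_ List.nodup_range
    intro i hi j hj h
    rw [List.mem_range] at hi hj
    simp only [Function.comp_apply] at h
    rcases abs_eq_abs.1 h with h | h
    · have := permValue_injective π h
      omega
    · rw [← permValue_neg hπ (succ_mem_plusMinus hj)] at h
      have := permValue_injective π h
      omega
  refine mem_words.2 ⟨hn, Finset.eq_of_subset_of_card_le ?_ ?_⟩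
  · intro x hx
    rw [List.mem_toFinset, permWord, List.map_map, List.mem_map] at hx
    obtain ⟨j, hj, rfl⟩ := hx
    rw [List.mem_range] at hj
    have := permValue_mem π (succ_mem_plusMinus hj)
    rw [mem_plusMinus] at this
    rw [Finset.mem_Icc, Function.comp_apply]
    exact ⟨Int.one_le_abs this.1, this.2⟩
  · rw [List.toFinset_card_of_nodup hn]
    simp [permWord]

theorem permWord_injOn (n : ℕ) :
    ∀ π ∈ coxeterB n, ∀ ρ ∈ coxeterB n, permWord π = permWord ρ → π = ρ := by
  intro π hπ ρ hρ h
  rw [permWord, permWord, List.map_inj_left] at h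
  have key : ∀ i : ℤ, 0 < i → i ∈ plusMinus n → permValue π i = permValue ρ i := by
    intro i hi hin
    rw [mem_plusMinus, abs_of_pos hi] at hin
    have := h (i - 1).toNat (List.mem_range.2 (by omega))
    rwa [show (((i - 1).toNat : ℕ) : ℤ) + 1 = i by omega] at this
  have key' : ∀ i ∈ plusMinus n, permValue π i = permValue ρ i := by
    intro i hi
    rcases lt_or_gt_of_ne (mem_plusMinus.1 hi).1 with h0 | h0
    · have := key (-i) (by omega) (neg_mem_plusMinus hi)
      rw [permValue_neg hπ hi, permValue_neg hρ hi] at this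
      exact neg_injective this
    · exact key i h0 hi
  ext ⟨i, hi⟩
  have := key' i hi
  rwa [permValue, permValue, Equiv.Perm.ofSubtype_apply_of_mem π hi,
    Equiv.Perm.ofSubtype_apply_of_mem ρ hi] at this

theorem exists_mem_coxeterB {n : ℕ} (g : ℕ → ℤ) (hg : ∀ j < n, g j ∈ plusMinus n)
    (hinj : ∀ i < n, ∀ j < n, |g i| = |g j| → i = j) :
    ∃ π ∈ coxeterB n, ∀ j < n, permValue π (j + 1) = g j := by
  -- The odd extension of `g`, whose indices start at 0; at `i = 0` the sign makes the truncated
  -- index harmless.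
  let v : ℤ → ℤ := fun i => i.sign * g (i.natAbs - 1)
  have hv : ∀ i, v (-i) = -v i := by
    intro i
    simp [v]
  have hlt : ∀ i ∈ plusMinus n, i.natAbs - 1 < n := by
    intro i hi
    rw [mem_plusMinus, Int.abs_eq_natAbs] at hi
    omega
  have habs : ∀ i ∈ plusMinus n, |v i| = |g (i.natAbs - 1)| := by
    intro i hi
    rw [mem_plusMinus] at hi
    simp only [v]
    rw [abs_mul, Int.abs_sign_of_ne_zero hi.1, one_mul]
  have hmem : ∀ i ∈ plusMinus n, v i ∈ plusMinus n := by
    intro i hi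
    have := hg _ (hlt i hi)
    rw [mem_plusMinus, ← abs_pos, ← habs i hi, abs_pos] at this
    exact mem_plusMinus.2 this
  have hvinj : ∀ i ∈ plusMinus n, ∀ j ∈ plusMinus n, v i = v j → i = j := by
    intro i hi j hj h
    have h1 : |g (i.natAbs - 1)| = |g (j.natAbs - 1)| := by rw [← habs i hi, ← habs j hj, h]
    have h2 := hinj _ (hlt i hi) _ (hlt j hj) h1
    have hi0 := (mem_plusMinus.1 hi).1
    have hj0 := (mem_plusMinus.1 hj).1
    have h3 : i.natAbs = j.natAbs := by omega
    rcases Int.natAbs_eq_natAbs_iff.1 h3 with h4 | h4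
    · exact h4
    · have h5 := (mem_plusMinus.1 (hmem j hj)).1
      rw [h4, hv] at h
      omega
  let f : plusMinus n → plusMinus n := fun i => ⟨v i, hmem i i.2⟩
  have hf : Function.Injective f := by
    intro i j h
    exact Subtype.ext (hvinj i i.2 j j.2 (congrArg Subtype.val h))
  let π : Equiv.Perm (plusMinus n) := Equiv.ofBijective f (Finite.injective_iff_bijective.1 hf)
  have hπ : ∀ i ∈ plusMinus n, permValue π i = v i := by
    intro i hi
    rw [permValue, Equiv.Perm.ofSubtype_apply_of_mem π hi]
    rfl
  refine ⟨π, ?_, ?_⟩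
  · rw [coxeterB, Finset.mem_filter]
    refine ⟨Finset.mem_univ _, fun i hi => ?_⟩
    rw [hπ i hi, hπ _ (neg_mem_plusMinus hi), hv]
  · intro j hj
    rw [hπ _ (succ_mem_plusMinus hj)]
    simp only [v]
    rw [Int.sign_eq_one_of_pos (by omega), one_mul]
    congr 1

theorem sum_coxeterB_permWord (n : ℕ) (F : List ℤ → ℚ) :
    ∑ π ∈ coxeterB n, F (permWord π) =
      ∑ l ∈ words (Finset.Icc 1 n), ∑ m ∈ signings l, F m := by
  have hpos : ∀ l ∈ words (Finset.Icc (1 : ℤ) n), ∀ a ∈ l, 0 < a := by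
    intro l hl a ha
    rw [← List.mem_toFinset, (mem_words.1 hl).2, Finset.mem_Icc] at ha
    omega
  rw [Finset.sum_sigma']
  refine Finset.sum_bij (fun π _ => ⟨(permWord π).map abs, permWord π⟩) ?_ ?_ ?_ ?_
  · intro π hπ
    have := abs_permWord_mem_words hπ
    exact Finset.mem_sigma.2 ⟨this, (mem_signings (hpos _ this)).2 rfl⟩
  · intro π hπ ρ hρ h
    rw [Sigma.mk.injEq] at h
    exact permWord_injOn n π hπ ρ hρ (eq_of_heq h.2)
  · rintro ⟨l, m⟩ h
    rw [Finset.mem_sigma] at h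
    obtain ⟨hl, hm⟩ := h
    rw [mem_signings (hpos _ hl)] at hm
    have hlen := length_of_mem_words hl
    obtain ⟨hn, hl'⟩ := mem_words.1 hl
    simp only at hm hn hl' hlen hl
    subst hm
    have hlen' : m.length = n := by simpa using hlen
    have hget : ∀ j, j < n → ∃ h : j < (m.map abs).length, (m.map abs)[j] = |m.getD j 0| := by
      intro j hj
      refine ⟨by simpa [hlen'] using hj, ?_⟩
      rw [List.getElem_map, List.getD_eq_getElem _ _ (by omega)]
    obtain ⟨π, hπ, h⟩ := exists_mem_coxeterB (n := n) (fun j => m.getD j 0) (by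
        intro j hj
        obtain ⟨h, h'⟩ := hget j hj
        have := List.getElem_mem h
        rw [h', ← List.mem_toFinset, hl', Finset.mem_Icc] at this
        rw [mem_plusMinus, ← abs_pos]
        exact ⟨by omega, this.2⟩) (by
        intro i hi j hj hij
        obtain ⟨h, h'⟩ := hget i hi
        obtain ⟨k, k'⟩ := hget j hj
        exact (hn.getElem_inj_iff).1 (h'.trans (hij.trans k'.symm)))
    have hw : permWord π = m := by
      refine List.ext_getElem (by simp [permWord, hlen']) fun j h1 h2 => ?_
      rw [hlen'] at h2
      simp only [permWord, List.getElem_map, List.getElem_range]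
      rw [h j h2, List.getD_eq_getElem _ _ (by omega)]
    exact ⟨π, hπ, by simp only [hw]⟩
  · intro π hπ
    rfl

theorem chainSign_map_range (f : ℕ → ℤ) (n : ℕ) :
    chainSign ((List.range (n + 1)).map f) =
      ∏ j ∈ Finset.range n, stepSign (f j) (f (j + 1)) := by
  induction n generalizing f with
  | zero => simp [chainSign]
  | succ n ih =>
    rw [Finset.prod_range_succ', mul_comm, zero_add, List.range_succ_eq_map, List.map_cons,
      List.map_map]
    have h := ih (f ∘ Nat.succ)
    rw [List.range_succ_eq_map, List.map_cons] at h ⊢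
    rw [chainSign, h]
    rfl

theorem countP_permWord {n : ℕ} (π : Equiv.Perm (plusMinus n)) :
    (permWord π).countP (· < 0) =
      ({i ∈ Finset.Icc (1 : ℤ) n | permValue π i < 0} : Finset ℤ).card := by
  rw [Finset.card_filter, Icc_one_eq_image, Finset.sum_image (by intro i _ j _ h; simpa using h),
    permWord]
  -- The type of `π` depends on `n`, so only its value function is kept for the induction.
  generalize permValue π = f
  clear π
  induction n with
  | zero => simp
  | succ n ih =>
    rw [List.range_succ, Finset.sum_range_succ, List.map_append, List.countP_append, ih]
    simp [List.countP_cons]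

/-- If `|x| < |y|`, then `-y, x, y` is monotone, with no descent or two; if `|x| > |y|`, then `x` is
a local extremum and there is exactly one. -/
theorem stepSign_neg_mul_stepSign {x y : ℤ} (h : |x| ≠ |y|) :
    stepSign (-y) x * stepSign x y = stepSign |x| |y| := by
  simp only [stepSign]
  rcases abs_cases x with ⟨hx, _⟩ | ⟨hx, _⟩ <;> rcases abs_cases y with ⟨hy, _⟩ | ⟨hy, _⟩ <;>
    rw [hx, hy] at h ⊢ <;> split_ifs <;> first | omega | norm_num

theorem neg_one_pow_desD {n : ℕ} {π : Equiv.Perm (plusMinus (n + 2))}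
    (hπ : π ∈ coxeterB (n + 2)) : (-1 : ℚ) ^ desD π = signD (permWord π) := by
  have h1 : (-1 : ℚ) ^ desD π =
      ∏ j ∈ Finset.range (n + 2), stepSign (wordD π j) (wordD π (j + 1)) := by
    rw [desD, ← Finset.prod_const, Finset.prod_filter, Icc_one_eq_image,
      Finset.prod_image (by intro i _ j _ h; simpa using h)]
    refine Finset.prod_congr rfl fun j _ => ?_
    rw [add_sub_cancel_right]
    rfl
  have hne : |permValue π 1| ≠ |permValue π 2| := by
    intro h
    have h2' : (2 : ℤ) ∈ plusMinus (n + 2) := succ_mem_plusMinus (j := 1) (by omega)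
    rcases abs_eq_abs.1 h with h | h
    · have := permValue_injective π h
      omega
    · rw [← permValue_neg hπ h2'] at h
      have := permValue_injective π h
      omega
  have h3 : signD (permWord π) = stepSign |permValue π 1| |permValue π 2| *
      chainSign ((List.range (n + 1)).map fun j : ℕ => permValue π ((j + 1 : ℕ) + 1)) := by
    rw [permWord, List.range_succ_eq_map, List.map_cons, List.map_map, List.range_succ_eq_map,
      List.map_cons, List.map_cons, signD]
    rfl
  -- The factors `j = 0` and `j = 1` are split off; they are the two steps around `π(1)`.
  rw [h1, h3, chainSign_map_range, Finset.prod_range_succ', Finset.prod_range_succ',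
    ← stepSign_neg_mul_stepSign hne, mul_assoc, mul_comm]
  congr 1
  simp [wordD, mul_comm]

-- Evaluation at `-1`

theorem eulerianD_eval_neg_one (n : ℕ) :
    (((eulerianD (n + 2)).eval (-1) : ℤ) : ℚ) =
      2 * (2 ^ n * (-1) ^ (n / 2)) *
        ((n + 2) * tangentNumber (n + 1) 1 - 2 * secantNumber (n + 2) 0) := by
  rw [← sum_words_evenSignD, ← sum_coxeterB_permWord, eulerianD, Polynomial.eval_finsetSum,
    coxeterD, Finset.sum_filter, Int.cast_sum]
  refine Finset.sum_congr rfl fun π hπ => ?_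
  rw [evenSignD, countP_permWord, ← neg_one_pow_desD hπ]
  split_ifs <;> simp

theorem corollary2p2 :
    (∀ n : ℕ, 2 ≤ n → (eulerianD (2 * n - 1)).eval (-1) = 0) ∧
    (∀ n : ℕ, 1 ≤ n →
      (((eulerianD (2 * n)).eval (-1) : ℤ) : ℚ) =
        (-4) ^ n * (secantNumber (2 * n) 0 - n * tangentNumber (2 * n - 1) 1)) := by
  constructor
  · intro n hn
    obtain ⟨k, rfl⟩ := Nat.exists_eq_add_of_le hn
    have h := eulerianD_eval_neg_one (2 * k + 1)
    -- The tangent index `2k + 2` is even and the secant index `2k + 3` is odd, so both terms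
    -- vanish.
    rw [tangentNumber_of_even ⟨k + 1, by ring⟩, secantNumber_of_odd ⟨k + 1, by ring⟩] at h
    rw [show 2 * (2 + k) - 1 = 2 * k + 1 + 2 by omega]
    have h' : (((eulerianD (2 * k + 1 + 2)).eval (-1) : ℤ) : ℚ) = 0 := by
      rw [h]
      ring
    exact_mod_cast h'
  · intro n hn
    obtain ⟨k, rfl⟩ := Nat.exists_eq_add_of_le hn
    have h := eulerianD_eval_neg_one (2 * k)
    rw [show 2 * (1 + k) = 2 * k + 2 by ring, show 2 * k + 2 - 1 = 2 * k + 1 by omega, h,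
      Nat.mul_div_cancel_left k two_pos, pow_mul, pow_add,
      show (-4 : ℚ) = 2 ^ 2 * (-1) by norm_num, mul_pow _ (-1 : ℚ) k]
    push_cast
    ring
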